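/- There is a universal constant $K\in(0,\infty)$ such that the following holds. Let $m,n\ge 1$ be integers and $\phi,\theta\in(0,1/2)$. Suppose there exists a $3$-query locally decodable code $C:\{-1,1\}^m\to\{-1,1\}^n$ of quality $(\phi,\theta)$, i.e. a function such that for every $t\in\{1,\dots,m\}$ there is a probability distribution $\mathcal A_t$ over $4$-tuples $(i,j,k,g)$, with $i,j,k\in\{1,\dots,n\}$ and $g:\{-1,1\}^3\to\{-1,1\}$, with the property that for every $\varepsilon\in\{-1,1\}^m$ and every $\delta\in\{-1,1\}^n$ differing from $C(\varepsilon)$ in at most $\phi n$ coordinates, we have $g(\delta_i,\delta_j,\delta_k)=\varepsilon_t$ with $\mathcal A_t$-probability at least $\frac12+\theta$. Then for every seminorm $\|\cdot\|$ on $\mathbb R^{3n}\otimes\mathbb R^{3n}\otimes\mathbb R^{3n}$ and every $q\in[2,\infty)$, $$\frac{m^{1/q}}{\log(n+1)}\cdot \mathsf S_{\|\cdot\|}\!\left(\frac{\theta}{8},\frac{\phi\theta}{27}\right)\le K\, C^{(q)}_{\|\cdot\|}\,\mathsf O_{\|\cdot\|};$$ equivalently, $\frac{m^{1/q}}{\log(n+1)}\le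 K\,\frac{C^{(q)}_{\|\cdot\|}\mathsf O_{\|\cdot\|}}{\mathsf S_{\|\cdot\|}(\theta/8,\phi\theta/27)}$, where the right-hand side is read as $+\infty$ if the denominator vanishes. Here, writing $N=3n$: * $C^{(q)}_{\|\cdot\|}$ is the cotype $q$ constant, the infimum of those $c\in(0,\infty)$ such that $\left(\sum_{i=1}^k\|x_i\|^q\right)^{1/q}\le c\left(\mathbb E\left\|\sum_{i=1}^k\varepsilon_ix_i\right\|^2\right)^{1/2}$ for every $k\in\mathbb N$ and every $x_1,\dots,x_k\in (\mathbb R^N)^{\otimes 3}$, where $\varepsilon$ is uniformly distributed in $\{-1,1\}^k$; * $\mathsf O_{\|\cdot\|}=\max_{\varepsilon\in\{-1,1\}^N}\|\varepsilon\otimes\varepsilon\otimes\varepsilon\|$; * $\mathsf S_{\|\cdot\|}(\alpha,\beta)=\min\|x\|$ over all $x\in(\mathbb R^N)^{\otimes 3}$ for which there are permutations $\pi,\sigma,\tau$ of $\{1,\dots,N\}$ such that $\left|\langle e_{\pi(j)}\otimes e_{\sigma(j)}\otimes e_{\tau(j)},x\rangle\right|\ge\alpha$ for every $j\in\{1,\dots,\lceil\beta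 N\rceil\}$, where $e_1,\dots,e_N$ is the standard basis of $\mathbb R^N$. -/

import Mathlib

open scoped TensorProduct BigOperators

noncomputable section

/-- A map `C : {-1,1}^m → {-1,1}^n` is a 3-query locally decodable code of quality `(φ, θ)`.
The set `{-1,1}` is `ℤˣ`. For every `t` there is a probability distribution on 4-tuples
`(i, j, k, g)` with `i, j, k` coordinates and `g : {-1,1}^3 → {-1,1}`, such that for every message
`ε` and every word `δ` differing from `C ε` in at most `φ n` coordinates, the event
`g (δ_i, δ_j, δ_k) = ε_t` has probability at least `1/2 + θ`. -/
def IsThreeQueryLDC {m n : ℕ} (φ θ : ℝ) (C : (Fin m → ℤˣ) → (Fin n → ℤˣ)) : Prop :=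
  ∀ t : Fin m, ∃ A : PMF (Fin n × Fin n × Fin n × (ℤˣ × ℤˣ × ℤˣ → ℤˣ)),
    ∀ (ε : Fin m → ℤˣ) (δ : Fin n → ℤˣ), (hammingDist δ (C ε) : ℝ) ≤ φ * n →
      ENNReal.ofReal (1 / 2 + θ) ≤
        A.toOuterMeasure {a | a.2.2.2 (δ a.1, δ a.2.1, δ a.2.2.1) = ε t}

/-- The cotype `q` constant of a real vector space with respect to a seminorm `p`: the infimum of
all `C ∈ (0, ∞)` such that
`(∑ i, p (x i) ^ q) ^ (1/q) ≤ C * (𝔼_ε p (∑ i, ε_i x_i) ^ 2) ^ (1/2)`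
for all finite families `x`, with `ε` uniform in `{-1,1}^k`. (For a finite-dimensional space and
`q ≥ 2`, the set of such `C` is non-empty.) -/
def cotypeConst {E : Type*} [AddCommGroup E] [Module ℝ E] (p : Seminorm ℝ E) (q : ℝ) : ℝ :=
  sInf {C : ℝ | 0 < C ∧ ∀ (k : ℕ) (x : Fin k → E),
    (∑ i, p (x i) ^ q) ^ (1 / q) ≤
      C * Real.sqrt (𝔼 ε : Fin k → ℤˣ, p (∑ i, ((ε i : ℤ) : ℝ) • x i) ^ 2)}

/-- The space `ℝ^N ⊗ ℝ^N ⊗ ℝ^N`. -/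
def Tensor3 (N : ℕ) : Type :=
  (Fin N → ℝ) ⊗[ℝ] (Fin N → ℝ) ⊗[ℝ] (Fin N → ℝ)

instance (N : ℕ) : AddCommGroup (Tensor3 N) :=
  inferInstanceAs (AddCommGroup (TensorProduct ℝ (TensorProduct ℝ (Fin N → ℝ) (Fin N → ℝ))
    (Fin N → ℝ)))

instance (N : ℕ) : Module ℝ (Tensor3 N) :=
  inferInstanceAs (Module ℝ (TensorProduct ℝ (TensorProduct ℝ (Fin N → ℝ) (Fin N → ℝ))
    (Fin N → ℝ)))

/-- The elementary tensor `u ⊗ v ⊗ w`. -/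
def Tensor3.tmul {N : ℕ} (u v w : Fin N → ℝ) : Tensor3 N := (u ⊗ₜ[ℝ] v) ⊗ₜ[ℝ] w

/-- The standard basis `e_i ⊗ e_j ⊗ e_k` of `ℝ^N ⊗ ℝ^N ⊗ ℝ^N`. -/
def Tensor3.basis (N : ℕ) : Module.Basis ((Fin N × Fin N) × Fin N) ℝ (Tensor3 N) :=
  ((Pi.basisFun ℝ (Fin N)).tensorProduct (Pi.basisFun ℝ (Fin N))).tensorProduct
    (Pi.basisFun ℝ (Fin N))

/-- The coordinate `⟨e_i ⊗ e_j ⊗ e_k, x⟩` of a tensor `x`, i.e. its coefficient at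
`e_i ⊗ e_j ⊗ e_k` in the standard basis. -/
def Tensor3.coeff {N : ℕ} (x : Tensor3 N) (i j k : Fin N) : ℝ :=
  (Tensor3.basis N).repr x ((i, j), k)

/-- A sign vector in `{-1,1}^N`, viewed in `ℝ^N`. -/
def signVec {N : ℕ} (ε : Fin N → ℤˣ) : Fin N → ℝ := fun i => ((ε i : ℤ) : ℝ)

/-- `O(p)`: the maximum of `p (ε ⊗ ε ⊗ ε)` over the sign vectors `ε ∈ {-1,1}^N`. -/
def maxSignCube {N : ℕ} (p : Seminorm ℝ (Tensor3 N)) : ℝ :=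
  ⨆ ε : Fin N → ℤˣ, p (Tensor3.tmul (signVec ε) (signVec ε) (signVec ε))

/-- The set `S(α, β)` of tensors for which there are permutations `π, σ, τ` such that the
coefficients at `e_{π j} ⊗ e_{σ j} ⊗ e_{τ j}`, for the first `⌈β N⌉` indices `j`, are all at
least `α` in absolute value. -/
def largeDiagSet (N : ℕ) (α β : ℝ) : Set (Tensor3 N) :=
  {x | ∃ π σ τ : Equiv.Perm (Fin N), ∀ j : Fin N, (j : ℕ) < ⌈β * N⌉₊ →
    α ≤ |x.coeff (π j) (σ j) (τ j)|}

/-- The minimum of the seminorm `p` on the set `S(α, β)`. -/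
def minLargeDiag {N : ℕ} (p : Seminorm ℝ (Tensor3 N)) (α β : ℝ) : ℝ :=
  sInf (p '' largeDiagSet N α β)

end

/-!
Let `C` be the code, pad its words with ones to length `N = 3 n` (`padOnes`), and consider the
function `f ε = F ε ⊗ F ε ⊗ F ε` on the cube `{-1,1}^m`, where `F ε` is the padded word of `ε`. The
proof compares two estimates for its Rademacher coefficients `x t = 𝔼 ε_t f ε`.

*Lower bound.* By the argument of Katz and Trevisan, randomizing a set `V` of at most `φ n`
coordinates of the codeword does not harm the decoder; as the Walsh functions whose support meets
`V` then average out, some product of one to three bits outside `V` must correlate with `ε_t`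
(`exists_correlated_disjoint`). A greedy choice gives at least `φ θ n / 9` disjoint sets of bits
of this kind. The padding turns each of them into a triple of positions without creating
collisions, and the correlations are coefficients of `x t`; so `x t` belongs to the set over which
`minLargeDiag` minimizes (`walshCoeff_signCube_padOnes_mem`).

*Upper bound.* By the definition of cotype (the infimum is attained, `cotype_inequality`, since a
finite-dimensional space has finite cotype constants) it suffices to bound the `L²` norm of the
Rademacher sum `∑ ε_t x t`, the degree-one part of `f`, by a multiple of `log N * maxSignCube p`.
This is Pisier's bound for the K-convexity constant (`cubeMean_sq_rademacher_le`). The noise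
operators with parameter `ρ ∈ [-1, 1]`, which scale the degree `k` part by `ρ ^ k`, are
contractions. A combination of them with `ρ ∈ [-1/2, 1/2]` and total mass `4 D` has symbol `1` at
`k = 1` and `0` at all other `k ≤ D` (`exists_derivative_quadrature`, from a Fejér kernel at the
roots of unity), and the symbol is exponentially small for `k > D`. To control the error no
auxiliary Hilbert space norm is needed: the Walsh expansion of `δ ↦ δ ⊗ δ ⊗ δ` writes `f` as a
combination, with signs as coefficients, of at most `N ^ 3` tensors of seminorm at most
`maxSignCube p`, and for scalar functions the error is bounded by Parseval. So `D` of order `log N`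
suffices.
-/

/-! ### Fourier analysis on the discrete cube -/

section Cube

variable {ι : Type*}

/-- The Walsh function `x ↦ ∏ i ∈ A, x i` on the cube. -/
def walsh (A : Finset ι) (x : ι → ℤˣ) : ℝ := ∏ i ∈ A, ((x i : ℤ) : ℝ)

lemma unit_sign_mul_self (u : ℤˣ) : ((u : ℤ) : ℝ) * ((u : ℤ) : ℝ) = 1 := by
  rcases Int.units_eq_one_or u with h | h <;> simp [h]

lemma abs_unit_sign (u : ℤˣ) : |((u : ℤ) : ℝ)| = 1 := by
  rcases Int.units_eq_one_or u with h | h <;> simp [h]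

lemma walsh_mul_self (A : Finset ι) (x : ι → ℤˣ) : walsh A x * walsh A x = 1 := by
  simp [walsh, ← Finset.prod_mul_distrib, unit_sign_mul_self]

lemma abs_walsh (A : Finset ι) (x : ι → ℤˣ) : |walsh A x| = 1 := by
  simp [walsh, Finset.abs_prod, abs_unit_sign]

lemma walsh_mul (A : Finset ι) (x y : ι → ℤˣ) : walsh A (x * y) = walsh A x * walsh A y := by
  simp [walsh, ← Finset.prod_mul_distrib]

lemma walsh_symmDiff [DecidableEq ι] (A B : Finset ι) (x : ι → ℤˣ) :
    walsh (symmDiff A B) x = walsh A x * walsh B x := by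
  have h : ∀ T ⊆ A ∪ B, walsh T x = ∏ i ∈ A ∪ B, if i ∈ T then ((x i : ℤ) : ℝ) else 1 := by
    intro T hT
    rw [Finset.prod_ite_mem, Finset.inter_eq_right.2 hT]
    rfl
  rw [h _ symmDiff_le_sup, h A Finset.subset_union_left, h B Finset.subset_union_right,
    ← Finset.prod_mul_distrib]
  refine Finset.prod_congr rfl fun i _ => ?_
  have := unit_sign_mul_self (x i)
  by_cases hA : i ∈ A <;> by_cases hB : i ∈ B <;> simp [Finset.mem_symmDiff, hA, hB, this]

lemma walsh_mulSingle [DecidableEq ι] (A : Finset ι) (i : ι) :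
    walsh A (Pi.mulSingle i (-1)) = if i ∈ A then -1 else 1 := by
  unfold walsh
  have : ∀ j, (((Pi.mulSingle i (-1) : ι → ℤˣ) j : ℤ) : ℝ) = if j = i then -1 else 1 := by
    intro j
    by_cases h : j = i
    · subst h; simp
    · simp [h]
  simp [this, Finset.prod_ite_eq']

/-- The Poisson kernel of the cube, in product form and as a Walsh series. -/
lemma prod_one_add_mul_sign [Fintype ι] (r : ℝ) (x y : ι → ℤˣ) :
    ∏ i, (1 + r * (((x i : ℤ) : ℝ) * ((y i : ℤ) : ℝ))) =
      ∑ A : Finset ι, r ^ A.card * (walsh A x * walsh A y) := by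
  rw [Finset.prod_one_add, Finset.powerset_univ]
  refine Finset.sum_congr rfl fun A _ => ?_
  rw [Finset.prod_mul_distrib, Finset.prod_mul_distrib, Finset.prod_const]
  rfl

variable [Fintype ι] [DecidableEq ι]
variable {E : Type*} [AddCommGroup E] [Module ℝ E]

/-- The mean of a function on the cube `{-1,1}^ι` with values in a real vector space. -/
noncomputable def cubeMean (f : (ι → ℤˣ) → E) : E :=
  (Fintype.card (ι → ℤˣ) : ℝ)⁻¹ • ∑ x, f x

/-- The Fourier coefficient of `f` at the Walsh function of `A`. -/
noncomputable def walshCoeff (f : (ι → ℤˣ) → E) (A : Finset ι) : E :=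
  cubeMean fun x => walsh A x • f x

/-- The Fourier multiplier that scales the part of `f` of degree `k` by `l k`. -/
noncomputable def degreeMultiplier (l : ℕ → ℝ) (f : (ι → ℤˣ) → E) (x : ι → ℤˣ) : E :=
  ∑ A : Finset ι, l A.card • walsh A x • walshCoeff f A

lemma cube_card_pos : (0 : ℝ) < (Fintype.card (ι → ℤˣ) : ℝ) := by
  exact_mod_cast Fintype.card_pos

lemma cubeMean_const (c : E) : cubeMean (fun _ : ι → ℤˣ => c) = c := by
  have := (cube_card_pos (ι := ι)).ne'
  rw [cubeMean, Finset.sum_const, Finset.card_univ, ← Nat.cast_smul_eq_nsmul ℝ, smul_smul,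
    inv_mul_cancel₀ this, one_smul]

lemma cubeMean_sum {β : Type*} (s : Finset β) (f : β → (ι → ℤˣ) → E) :
    cubeMean (fun x => ∑ b ∈ s, f b x) = ∑ b ∈ s, cubeMean (f b) := by
  simp only [cubeMean]
  rw [Finset.sum_comm, Finset.smul_sum]

lemma cubeMean_add (f g : (ι → ℤˣ) → E) :
    cubeMean (fun x => f x + g x) = cubeMean f + cubeMean g := by
  simp only [cubeMean, Finset.sum_add_distrib, smul_add]

lemma cubeMean_smul (c : ℝ) (f : (ι → ℤˣ) → E) :
    cubeMean (fun x => c • f x) = c • cubeMean f := by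
  simp only [cubeMean]
  rw [← Finset.smul_sum, smul_comm]

lemma cubeMean_mul (c : ℝ) (f : (ι → ℤˣ) → ℝ) :
    cubeMean (fun x => c * f x) = c * cubeMean f := cubeMean_smul c f

lemma cubeMean_smul_const (f : (ι → ℤˣ) → ℝ) (v : E) :
    cubeMean (fun x => f x • v) = cubeMean f • v := by
  simp only [cubeMean]
  rw [← Finset.sum_smul, smul_assoc]

lemma cubeMean_mono {f g : (ι → ℤˣ) → ℝ} (h : ∀ x, f x ≤ g x) : cubeMean f ≤ cubeMean g := by
  simp only [cubeMean, smul_eq_mul]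
  have := (cube_card_pos (ι := ι)).le
  gcongr
  exact h _

lemma cubeMean_eq_expect (f : (ι → ℤˣ) → ℝ) : 𝔼 x, f x = cubeMean f := by
  rw [Fintype.expect_eq_sum_div_card, cubeMean, smul_eq_mul, div_eq_inv_mul]

lemma seminorm_cubeMean_le (p : Seminorm ℝ E) (f : (ι → ℤˣ) → E) :
    p (cubeMean f) ≤ cubeMean fun x => p (f x) := by
  simp only [cubeMean, map_smul_eq_mul, norm_inv, Real.norm_natCast, smul_eq_mul]
  have := (cube_card_pos (ι := ι)).le
  gcongr
  exact Finset.le_sum_of_subadditive p (map_zero p).le (map_add_le_add p) Finset.univ f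

lemma abs_cubeMean_le (f : (ι → ℤˣ) → ℝ) : |cubeMean f| ≤ cubeMean fun x => |f x| := by
  simp only [cubeMean, smul_eq_mul, abs_mul, abs_inv, Nat.abs_cast]
  have := (cube_card_pos (ι := ι)).le
  gcongr
  exact Finset.abs_sum_le_sum_abs _ _

lemma map_cubeMean {F : Type*} [AddCommGroup F] [Module ℝ F] (φ : E →ₗ[ℝ] F)
    (f : (ι → ℤˣ) → E) : φ (cubeMean f) = cubeMean fun x => φ (f x) := by
  simp [cubeMean, map_sum]

/-- A function on the cube that changes sign under multiplication by a fixed point has mean `0`. -/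
lemma cubeMean_eq_zero_of_neg (f : (ι → ℤˣ) → ℝ) (y : ι → ℤˣ) (h : ∀ x, f (x * y) = -f x) :
    cubeMean f = 0 := by
  have h1 : ∑ x, f x = ∑ x, f (x * y) := (Equiv.sum_comp (Equiv.mulRight y) f).symm
  have h2 : ∑ x, f x = 0 := by
    simp only [h, Finset.sum_neg_distrib] at h1
    linarith
  simp [cubeMean, h2]

lemma cubeMean_walsh_mul_walsh (A B : Finset ι) :
    cubeMean (fun x => walsh A x * walsh B x) = if A = B then 1 else 0 := by
  split_ifs with h
  · subst h
    simp only [walsh_mul_self]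
    exact cubeMean_const _
  · obtain ⟨i, hi⟩ : ∃ i, ¬ (i ∈ A ↔ i ∈ B) := by
      by_contra hc
      push Not at hc
      exact h (Finset.ext hc)
    refine cubeMean_eq_zero_of_neg _ (Pi.mulSingle i (-1)) fun x => ?_
    rw [walsh_mul, walsh_mul, walsh_mulSingle, walsh_mulSingle]
    by_cases hA : i ∈ A <;> by_cases hB : i ∈ B <;> simp_all

lemma sum_walsh_mul_walsh (x y : ι → ℤˣ) :
    ∑ A : Finset ι, walsh A x * walsh A y =
      if x = y then (Fintype.card (ι → ℤˣ) : ℝ) else 0 := by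
  have h := prod_one_add_mul_sign 1 x y
  simp only [one_pow, one_mul] at h
  rw [← h]
  split_ifs with hxy
  · subst hxy
    simp only [unit_sign_mul_self]
    norm_num [Fintype.card_pi, Finset.prod_const]
  · obtain ⟨i, hi⟩ := Function.ne_iff.1 hxy
    refine Finset.prod_eq_zero (Finset.mem_univ i) ?_
    rcases Int.units_eq_one_or (x i) with h1 | h1 <;>
      rcases Int.units_eq_one_or (y i) with h2 | h2 <;> simp_all

lemma degreeMultiplier_eq_cubeMean (l : ℕ → ℝ) (f : (ι → ℤˣ) → E) (x : ι → ℤˣ) :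
    degreeMultiplier l f x =
      cubeMean fun y => (∑ A : Finset ι, l A.card * (walsh A x * walsh A y)) • f y := by
  simp only [degreeMultiplier, walshCoeff, ← cubeMean_smul, ← cubeMean_sum, Finset.sum_smul,
    smul_smul]

/-- Fourier inversion on the cube. -/
lemma sum_walsh_smul_walshCoeff (f : (ι → ℤˣ) → E) (x : ι → ℤˣ) :
    ∑ A : Finset ι, walsh A x • walshCoeff f A = f x := by
  have h := degreeMultiplier_eq_cubeMean (fun _ => 1) f x
  simp only [degreeMultiplier, one_smul, one_mul, sum_walsh_mul_walsh] at h
  rw [h, cubeMean]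
  simp only [ite_smul, zero_smul, Finset.sum_ite_eq, Finset.mem_univ, if_true]
  rw [smul_smul, inv_mul_cancel₀ cube_card_pos.ne', one_smul]

lemma cubeMean_sq_sum_walsh (c : Finset ι → ℝ) :
    cubeMean (fun x => (∑ A : Finset ι, walsh A x * c A) ^ 2) = ∑ A, c A ^ 2 := by
  have h : ∀ x : ι → ℤˣ, (∑ A : Finset ι, walsh A x * c A) ^ 2 =
      ∑ A : Finset ι, ∑ B : Finset ι, (c A * c B) * (walsh A x * walsh B x) := by
    intro x
    rw [sq, Finset.sum_mul_sum]
    exact Finset.sum_congr rfl fun A _ => Finset.sum_congr rfl fun B _ => by ring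
  simp only [h, cubeMean_sum, cubeMean_mul, cubeMean_walsh_mul_walsh]
  simp [sq]

/-- A multiplier with symbol bounded by `η` has norm at most `η` on scalar-valued `L²`. -/
lemma cubeMean_sq_degreeMultiplier_le (l : ℕ → ℝ) (η : ℝ) (hl : ∀ k, |l k| ≤ η)
    (g : (ι → ℤˣ) → ℝ) :
    cubeMean (fun x => degreeMultiplier l g x ^ 2) ≤ η ^ 2 * cubeMean fun x => g x ^ 2 := by
  have h1 : ∀ x, degreeMultiplier l g x =
      ∑ A : Finset ι, walsh A x * (l A.card * walshCoeff g A) := by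
    intro x
    exact Finset.sum_congr rfl fun A _ => by simp only [smul_eq_mul]; ring
  have h2 : cubeMean (fun x => g x ^ 2) = ∑ A, walshCoeff g A ^ 2 := by
    rw [← cubeMean_sq_sum_walsh]
    congr 1
    funext x
    rw [← sum_walsh_smul_walshCoeff g x]
    rfl
  simp only [h1, cubeMean_sq_sum_walsh, h2, Finset.mul_sum, mul_pow]
  refine Finset.sum_le_sum fun A _ => mul_le_mul_of_nonneg_right ?_ (sq_nonneg _)
  exact sq_le_sq' (neg_le_of_abs_le (hl _)) (le_of_abs_le (hl _))

/-- The noise operator with parameter `r ∈ [-1, 1]` averages against a probability kernel, hence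
it contracts the sup norm for every seminorm on the target. -/
lemma seminorm_noise_le (p : Seminorm ℝ E) {f : (ι → ℤˣ) → E} {M : ℝ} (hf : ∀ x, p (f x) ≤ M)
    {r : ℝ} (hr : |r| ≤ 1) (x : ι → ℤˣ) : p (degreeMultiplier (fun k => r ^ k) f x) ≤ M := by
  have hpos : ∀ y : ι → ℤˣ, 0 ≤ ∑ A : Finset ι, r ^ A.card * (walsh A x * walsh A y) := by
    intro y
    rw [← prod_one_add_mul_sign]
    refine Finset.prod_nonneg fun i _ => ?_
    have : |r * (((x i : ℤ) : ℝ) * ((y i : ℤ) : ℝ))| ≤ 1 := by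
      rw [abs_mul, abs_mul, abs_unit_sign, abs_unit_sign]
      simpa using hr
    linarith [neg_le_of_abs_le this]
  have hone : cubeMean (fun y : ι → ℤˣ =>
      ∑ A : Finset ι, r ^ A.card * (walsh A x * walsh A y)) = 1 := by
    have h0 : ∀ A : Finset ι, cubeMean (walsh A) = if A = ∅ then 1 else 0 := by
      intro A
      rw [← cubeMean_walsh_mul_walsh A ∅]
      simp only [walsh, Finset.prod_empty, mul_one]
      rfl
    simp only [cubeMean_sum, cubeMean_mul, h0]
    simp [walsh]
  rw [degreeMultiplier_eq_cubeMean]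
  calc _ ≤ cubeMean fun y => p ((∑ A : Finset ι, r ^ A.card * (walsh A x * walsh A y)) • f y) :=
        seminorm_cubeMean_le _ _
    _ ≤ cubeMean fun y => M * ∑ A : Finset ι, r ^ A.card * (walsh A x * walsh A y) := by
        refine cubeMean_mono fun y => ?_
        rw [map_smul_eq_mul, Real.norm_of_nonneg (hpos y), mul_comm]
        exact mul_le_mul_of_nonneg_right (hf y) (hpos y)
    _ = M := by rw [cubeMean_mul, hone, mul_one]

/-- The degree-one part of `f` is its Rademacher projection. -/
lemma degreeMultiplier_one (f : (ι → ℤˣ) → E) (x : ι → ℤˣ) :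
    degreeMultiplier (fun k => if k = 1 then 1 else 0) f x =
      ∑ i, ((x i : ℤ) : ℝ) • walshCoeff f {i} := by
  have hinj : Set.InjOn (fun i : ι => ({i} : Finset ι)) (Finset.univ : Finset ι) :=
    fun i _ j _ h => Finset.singleton_injective h
  have : ∀ i, ((x i : ℤ) : ℝ) • walshCoeff f {i} = walsh {i} x • walshCoeff f {i} := by
    intro i; simp [walsh]
  simp only [this, degreeMultiplier, ite_smul, one_smul, zero_smul]
  rw [← Finset.sum_image (f := fun A => walsh A x • walshCoeff f A) hinj, ← Finset.sum_filter]
  refine Finset.sum_congr ?_ fun _ _ => rfl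
  ext A
  simp [Finset.card_eq_one, eq_comm]

lemma degreeMultiplier_symbol_sum {β : Type*} (s : Finset β) (c : β → ℝ) (l : β → ℕ → ℝ)
    (f : (ι → ℤˣ) → E) (x : ι → ℤˣ) :
    degreeMultiplier (fun k => ∑ b ∈ s, c b * l b k) f x =
      ∑ b ∈ s, c b • degreeMultiplier (l b) f x := by
  simp only [degreeMultiplier, Finset.smul_sum, Finset.sum_smul, mul_smul]
  exact Finset.sum_comm

lemma degreeMultiplier_symbol_sub (l l' : ℕ → ℝ) (f : (ι → ℤˣ) → E) (x : ι → ℤˣ) :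
    degreeMultiplier (fun k => l k - l' k) f x =
      degreeMultiplier l f x - degreeMultiplier l' f x := by
  simp only [degreeMultiplier, sub_smul, Finset.sum_sub_distrib]

lemma degreeMultiplier_sum {β : Type*} (s : Finset β) (g : β → (ι → ℤˣ) → ℝ) (v : β → E)
    (l : ℕ → ℝ) (x : ι → ℤˣ) :
    degreeMultiplier l (fun y => ∑ b ∈ s, g b y • v b) x =
      ∑ b ∈ s, degreeMultiplier l (g b) x • v b := by
  simp only [degreeMultiplier_eq_cubeMean, ← cubeMean_smul_const, ← cubeMean_sum, Finset.smul_sum,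
    smul_assoc]

end Cube

/-! ### Interpolation of the derivative at zero -/

section Interpolation

open Complex

lemma sum_zpow_of_isPrimitiveRoot {M : ℕ} {ζ : ℂ} (h : IsPrimitiveRoot ζ M) (s : ℤ) :
    ∑ j ∈ Finset.range M, (ζ ^ j) ^ s = if (M : ℤ) ∣ s then (M : ℂ) else 0 := by
  have h1 : ∀ j : ℕ, (ζ ^ j) ^ s = (ζ ^ s) ^ j := by
    intro j
    rw [← zpow_natCast, ← zpow_natCast, ← zpow_mul, ← zpow_mul, mul_comm]
  simp only [h1]
  split_ifs with hs
  · rw [(h.zpow_eq_one_iff_dvd s).2 hs]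
    simp
  · have hne : ζ ^ s ≠ 1 := fun hc => hs ((h.zpow_eq_one_iff_dvd s).1 hc)
    have h2 : (ζ ^ s) ^ M = 1 := by
      rw [← h1, h.pow_eq_one, one_zpow]
    rw [geom_sum_eq hne, h2, sub_self, zero_div]

lemma sum_range_ite_add (D r : ℕ) (hr : r ≤ D) :
    ∑ a ∈ Finset.range D, ∑ b ∈ Finset.range D, (if b = a + (D - r) then (1 : ℂ) else 0) = r := by
  have h1 : ∀ a ∈ Finset.range D,
      ∑ b ∈ Finset.range D, (if b = a + (D - r) then (1 : ℂ) else 0) =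
        if a < r then 1 else 0 := by
    intro a _
    rw [Finset.sum_ite_eq']
    refine if_congr ?_ rfl rfl
    rw [Finset.mem_range]
    omega
  rw [Finset.sum_congr rfl h1, ← Finset.sum_filter]
  have : (Finset.range D).filter (fun a => a < r) = Finset.range r := by
    ext a
    simp only [Finset.mem_filter, Finset.mem_range]
    omega
  rw [this]
  simp

/-- The number of pairs `a, b < D` with `a - b = -(D + l)`. -/
lemma sum_range_ite_eq_zero (D : ℕ) (l : ℤ) (hl : -(D : ℤ) ≤ l) :
    ∑ a ∈ Finset.range D, ∑ b ∈ Finset.range D,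
      (if (D : ℤ) + l + a - b = 0 then (1 : ℂ) else 0) = (max (-l) 0 : ℤ) := by
  rcases le_total l 0 with h | h
  · obtain ⟨r, rfl⟩ : ∃ r : ℕ, l = -r := ⟨l.natAbs, by omega⟩
    rw [max_eq_left (by omega)]
    have := sum_range_ite_add D r (by omega)
    push_cast
    rw [neg_neg, ← this]
    refine Finset.sum_congr rfl fun a _ => Finset.sum_congr rfl fun b _ => if_congr ?_ rfl rfl
    omega
  · rw [max_eq_right (by omega)]
    refine (Finset.sum_eq_zero fun a _ => Finset.sum_eq_zero fun b hb => ?_).trans (by simp)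
    rw [Finset.mem_range] at hb
    rw [if_neg (by omega)]

/-- The Fejér-type weight `2 sin(D x) |∑_{a < D} e^{iax}|²` at `z = e^{ix}`. -/
noncomputable def rieszWeight (D : ℕ) (z : ℂ) : ℂ :=
  (z ^ (D : ℤ) - z ^ (-(D : ℤ))) / I *
    ((∑ a ∈ Finset.range D, z ^ (a : ℤ)) * ∑ b ∈ Finset.range D, z ^ (-(b : ℤ)))

/-- The functional `g ↦ g'(0)` on trigonometric polynomials of degree at most `D`, as a
combination of the values at the `3D`-th roots of unity. -/
lemma sum_rieszWeight_mul_zpow {D : ℕ} (hD : 0 < D) {ζ : ℂ} (h : IsPrimitiveRoot ζ (3 * D))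
    (l : ℤ) (hl : |l| ≤ D) :
    ∑ j ∈ Finset.range (3 * D), rieszWeight D (ζ ^ j) * (ζ ^ j) ^ l = (3 * D : ℕ) * (I * l) := by
  obtain ⟨hl1, hl2⟩ := abs_le.1 hl
  have hζ : ζ ≠ 0 := h.ne_zero (by omega)
  have hexp : ∀ j : ℕ, rieszWeight D (ζ ^ j) * (ζ ^ j) ^ l =
      (∑ a ∈ Finset.range D, ∑ b ∈ Finset.range D,
        ((ζ ^ j) ^ ((D : ℤ) + l + a - b) - (ζ ^ j) ^ (-((D : ℤ) + -l + b - a)))) / I := by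
    intro j
    have hz : ζ ^ j ≠ 0 := pow_ne_zero _ hζ
    rw [rieszWeight, Finset.sum_mul_sum, div_mul_eq_mul_div, div_mul_eq_mul_div, mul_assoc,
      Finset.sum_mul, Finset.mul_sum]
    congr 1
    refine Finset.sum_congr rfl fun a _ => ?_
    rw [Finset.sum_mul, Finset.mul_sum]
    refine Finset.sum_congr rfl fun b _ => ?_
    rw [sub_mul, ← zpow_add₀ hz, ← zpow_add₀ hz, ← zpow_add₀ hz, ← zpow_add₀ hz]
    congr 2 <;> ring
  have hcount : ∀ l' : ℤ, |l'| ≤ D → ∀ a ∈ Finset.range D, ∀ b ∈ Finset.range D,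
      (if ((3 * D : ℕ) : ℤ) ∣ (D : ℤ) + l' + a - b then ((3 * D : ℕ) : ℂ) else 0) =
        (3 * D : ℕ) * (if (D : ℤ) + l' + a - b = 0 then (1 : ℂ) else 0) := by
    intro l' hl' a ha b hb
    obtain ⟨h1, h2⟩ := abs_le.1 hl'
    rw [Finset.mem_range] at ha hb
    rw [mul_ite, mul_one, mul_zero]
    refine if_congr ⟨fun hd => ?_, fun h0 => h0 ▸ dvd_zero _⟩ rfl rfl
    refine Int.eq_zero_of_abs_lt_dvd hd ?_
    rw [abs_lt]
    push_cast
    constructor <;> linarith [Nat.cast_nonneg (α := ℤ) a, Nat.cast_nonneg (α := ℤ) b,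
      (by exact_mod_cast ha : (a : ℤ) < D), (by exact_mod_cast hb : (b : ℤ) < D)]
  simp only [hexp]
  rw [← Finset.sum_div, Finset.sum_comm]
  have h1 : ∀ a ∈ Finset.range D, ∑ j ∈ Finset.range (3 * D), ∑ b ∈ Finset.range D,
      ((ζ ^ j) ^ ((D : ℤ) + l + a - b) - (ζ ^ j) ^ (-((D : ℤ) + -l + b - a))) =
      ∑ b ∈ Finset.range D, ((3 * D : ℕ) * (if (D : ℤ) + l + a - b = 0 then (1 : ℂ) else 0) -
        (3 * D : ℕ) * (if (D : ℤ) + -l + b - a = 0 then (1 : ℂ) else 0)) := by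
    intro a ha
    rw [Finset.sum_comm]
    refine Finset.sum_congr rfl fun b hb => ?_
    rw [Finset.sum_sub_distrib, sum_zpow_of_isPrimitiveRoot h,
      sum_zpow_of_isPrimitiveRoot h, ← hcount l hl a ha b hb,
      ← hcount (-l) (by rwa [abs_neg]) b hb a ha]
    simp only [dvd_neg]
  rw [Finset.sum_congr rfl h1]
  simp only [Finset.sum_sub_distrib, ← Finset.mul_sum]
  rw [sum_range_ite_eq_zero D l hl1]
  rw [Finset.sum_comm (s := Finset.range D) (t := Finset.range D)
    (f := fun a b => if (D : ℤ) + -l + b - a = 0 then (1 : ℂ) else 0),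
    sum_range_ite_eq_zero D (-l) (by omega), neg_neg, ← mul_sub, mul_div_assoc]
  congr 1
  have : (max (-l) 0 - max l 0 : ℤ) = -l := by
    rcases le_total l 0 with h | h
    · rw [max_eq_left (by omega), max_eq_right h]; ring
    · rw [max_eq_right (by omega), max_eq_left h]; ring
  rw [← Int.cast_sub, this, div_I]
  push_cast
  ring

/-- The derivative at `0` of `e^{ilx} sin^k x` is obtained from the values at roots of unity. -/
lemma sum_rieszWeight_mul_sin_pow {D : ℕ} (hD : 0 < D) {ζ : ℂ} (h : IsPrimitiveRoot ζ (3 * D))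
    (k : ℕ) (l : ℤ) (hl : |l| + k ≤ D) :
    ∑ j ∈ Finset.range (3 * D), rieszWeight D (ζ ^ j) *
      ((ζ ^ j) ^ l * ((ζ ^ j - (ζ ^ j)⁻¹) / (2 * I)) ^ k) =
      (3 * D : ℕ) * (if k = 0 then I * l else if k = 1 then 1 else 0) := by
  induction k generalizing l with
  | zero => simpa using sum_rieszWeight_mul_zpow hD h l (by simpa using hl)
  | succ k ih =>
    have hζ : ζ ≠ 0 := h.ne_zero (by omega)
    have h1 := ih (l + 1) (by have := abs_add_le l 1; push_cast at hl; norm_num at this; linarith)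
    have h2 := ih (l - 1) (by have := abs_sub l 1; push_cast at hl; norm_num at this; linarith)
    have h3 : ∀ j : ℕ, rieszWeight D (ζ ^ j) *
        ((ζ ^ j) ^ l * ((ζ ^ j - (ζ ^ j)⁻¹) / (2 * I)) ^ (k + 1)) =
        (rieszWeight D (ζ ^ j) * ((ζ ^ j) ^ (l + 1) * ((ζ ^ j - (ζ ^ j)⁻¹) / (2 * I)) ^ k) -
        rieszWeight D (ζ ^ j) * ((ζ ^ j) ^ (l - 1) * ((ζ ^ j - (ζ ^ j)⁻¹) / (2 * I)) ^ k)) /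
          (2 * I) := by
      intro j
      have hz : ζ ^ j ≠ 0 := pow_ne_zero _ hζ
      rw [zpow_add_one₀ hz, zpow_sub_one₀ hz, pow_succ]
      ring
    simp only [h3]
    rw [← Finset.sum_div, Finset.sum_sub_distrib, h1, h2]
    rcases k with _ | k
    · have := I_ne_zero
      simp
      field_simp
      ring
    · simp

/-- Bernstein's inequality in dual form: on polynomials of degree at most `D`, the functional
`P ↦ P'(0)` is a combination of point values in `[-1/2, 1/2]` of total mass at most `4 D`. -/
theorem exists_derivative_quadrature {D : ℕ} (hD : 0 < D) :
    ∃ (c ρ : ℕ → ℝ), (∀ j, |ρ j| ≤ 1 / 2) ∧ ∑ j ∈ Finset.range (3 * D), |c j| ≤ 4 * D ∧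
      ∀ k ≤ D, ∑ j ∈ Finset.range (3 * D), c j * ρ j ^ k = if k = 1 then 1 else 0 := by
  have hM : (0 : ℝ) < (3 * D : ℕ) := by exact_mod_cast (by omega : 0 < 3 * D)
  set ζ : ℂ := exp (2 * Real.pi * I / (3 * D : ℕ)) with hζdef
  have h : IsPrimitiveRoot ζ (3 * D) := isPrimitiveRoot_exp _ (by omega)
  let x : ℕ → ℝ := fun j => j * (2 * Real.pi / (3 * D : ℕ))
  have hx : ∀ j, ζ ^ j = exp (x j * I) := by
    intro j
    rw [hζdef, ← exp_nat_mul]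
    congr 1
    simp only [x]
    push_cast
    ring
  have hinv : ∀ j, (ζ ^ j)⁻¹ = exp (-(x j * I)) := by
    intro j
    rw [hx, ← exp_neg]
  have hsin : ∀ j, ((Real.sin (x j) : ℝ) : ℂ) = (ζ ^ j - (ζ ^ j)⁻¹) / (2 * I) := by
    intro j
    rw [hinv, hx, ofReal_sin, Complex.sin, neg_mul]
    field_simp
    rw [I_sq]
    ring
  have hsinD : ∀ j, ((2 * Real.sin (D * x j) : ℝ) : ℂ) =
      ((ζ ^ j) ^ (D : ℤ) - (ζ ^ j) ^ (-(D : ℤ))) / I := by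
    intro j
    rw [zpow_neg, ← inv_zpow, hinv, hx, zpow_natCast, zpow_natCast, ← exp_nat_mul, ← exp_nat_mul,
      ofReal_mul, ofReal_sin, Complex.sin]
    push_cast
    field_simp
    rw [I_sq]
    ring_nf
  have hnorm : ∀ j, ((normSq (∑ a ∈ Finset.range D, (ζ ^ j) ^ a) : ℝ) : ℂ) =
      (∑ a ∈ Finset.range D, (ζ ^ j) ^ (a : ℤ)) *
        ∑ b ∈ Finset.range D, (ζ ^ j) ^ (-(b : ℤ)) := by
    intro j
    rw [normSq_eq_conj_mul_self, mul_comm, map_sum]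
    congr 1
    refine Finset.sum_congr rfl fun b _ => ?_
    rw [map_pow, zpow_neg, ← inv_zpow, hinv, hx, zpow_natCast, ← exp_conj]
    simp
  have hweight : ∀ j, ((2 * Real.sin (D * x j) *
      normSq (∑ a ∈ Finset.range D, (ζ ^ j) ^ a) : ℝ) : ℂ) = rieszWeight D (ζ ^ j) := by
    intro j
    rw [ofReal_mul, hsinD, hnorm, rieszWeight]
  refine ⟨fun j => 2 / (3 * D : ℕ) * (2 * Real.sin (D * x j) *
      normSq (∑ a ∈ Finset.range D, (ζ ^ j) ^ a)), fun j => Real.sin (x j) / 2, ?_, ?_, ?_⟩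
  · intro j
    rw [abs_div, abs_two]
    linarith [Real.abs_sin_le_one (x j)]
  · have hmass : ∑ j ∈ Finset.range (3 * D), normSq (∑ a ∈ Finset.range D, (ζ ^ j) ^ a) =
        (3 * D : ℕ) * D := by
      have hζ0 : ζ ≠ 0 := h.ne_zero (by omega)
      apply ofReal_injective
      rw [ofReal_sum]
      simp only [hnorm, Finset.sum_mul_sum]
      rw [Finset.sum_comm]
      have h1 : ∀ a ∈ Finset.range D, ∑ j ∈ Finset.range (3 * D), ∑ b ∈ Finset.range D,
          (ζ ^ j) ^ (a : ℤ) * (ζ ^ j) ^ (-(b : ℤ)) = (3 * D : ℕ) := by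
        intro a ha
        rw [Finset.sum_comm]
        have h2 : ∀ b ∈ Finset.range D, ∑ j ∈ Finset.range (3 * D),
            (ζ ^ j) ^ (a : ℤ) * (ζ ^ j) ^ (-(b : ℤ)) = if b = a then ((3 * D : ℕ) : ℂ) else 0 := by
          intro b hb
          rw [Finset.mem_range] at ha hb
          simp only [← zpow_add₀ (pow_ne_zero _ hζ0)]
          rw [sum_zpow_of_isPrimitiveRoot h]
          refine if_congr ⟨fun hd => ?_, fun h0 => by simp [h0]⟩ rfl rfl
          have := Int.eq_zero_of_abs_lt_dvd hd (by rw [abs_lt]; constructor <;> omega)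
          omega
        rw [Finset.sum_congr rfl h2, Finset.sum_ite_eq', if_pos ha]
      rw [Finset.sum_congr rfl h1]
      simp [mul_comm]
    calc _ ≤ ∑ j ∈ Finset.range (3 * D), 4 / ((3 * D : ℕ) : ℝ) *
          normSq (∑ a ∈ Finset.range D, (ζ ^ j) ^ a) := by
          refine Finset.sum_le_sum fun j _ => ?_
          rw [abs_mul, abs_mul, abs_mul, abs_of_nonneg (normSq_nonneg _), abs_two,
            abs_of_pos (by positivity : (0 : ℝ) < 2 / (3 * D : ℕ))]
          have h1 := Real.abs_sin_le_one (D * x j)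
          have h2 := normSq_nonneg (∑ a ∈ Finset.range D, (ζ ^ j) ^ a)
          calc _ ≤ 2 / ((3 * D : ℕ) : ℝ) * (2 * 1 *
                normSq (∑ a ∈ Finset.range D, (ζ ^ j) ^ a)) := by gcongr
            _ = _ := by ring
      _ = 4 * D := by
          rw [← Finset.mul_sum, hmass]
          field_simp
  · intro k hk
    have hmain := sum_rieszWeight_mul_sin_pow hD h k 0 (by simpa using hk)
    apply ofReal_injective
    rw [ofReal_sum]
    have hterm : ∀ j, ((2 / (3 * D : ℕ) * (2 * Real.sin (D * x j) *
        normSq (∑ a ∈ Finset.range D, (ζ ^ j) ^ a)) * (Real.sin (x j) / 2) ^ k : ℝ) : ℂ) =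
        2 / (3 * D : ℕ) / 2 ^ k * (rieszWeight D (ζ ^ j) *
          ((ζ ^ j) ^ (0 : ℤ) * ((ζ ^ j - (ζ ^ j)⁻¹) / (2 * I)) ^ k)) := by
      intro j
      rw [← hweight, ← hsin]
      push_cast
      rw [zpow_zero, div_pow]
      ring
    simp only [hterm]
    rw [← Finset.mul_sum, hmain]
    have hM' : ((3 * D : ℕ) : ℂ) ≠ 0 := by exact_mod_cast (by omega : 3 * D ≠ 0)
    rcases k with _ | _ | k
    · simp
    · rw [if_neg (by omega), if_pos rfl]
      simp only [zero_add, pow_one, if_true, ofReal_one]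
      field_simp
    · simp

end Interpolation

/-! ### Rademacher projections -/

section Rademacher

variable {ι : Type*} [Fintype ι] [DecidableEq ι]
variable {E : Type*} [AddCommGroup E] [Module ℝ E]

/-- Pisier's logarithmic bound for the Rademacher projection, for a function that takes values in
the `p`-ball of radius `M` and is a combination, with coefficients bounded by `1`, of at most
`2 ^ D` vectors of that ball. The degree-one part is approximated by a combination of noise
operators, and the error, being of order `D / 2 ^ D` on scalar-valued `L²`, is absorbed by the
number of vectors. -/
theorem cubeMean_sq_rademacher_le (p : Seminorm ℝ E) {β : Type*} (s : Finset β)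
    (g : β → (ι → ℤˣ) → ℝ) (v : β → E) {D : ℕ} (hD : 0 < D) (hs : s.card ≤ 2 ^ D) {M : ℝ}
    (hg : ∀ b x, |g b x| ≤ 1) (hv : ∀ b, p (v b) ≤ M) (f : (ι → ℤˣ) → E)
    (hf : ∀ x, f x = ∑ b ∈ s, g b x • v b) (hfM : ∀ x, p (f x) ≤ M) :
    cubeMean (fun x => p (∑ i, ((x i : ℤ) : ℝ) • walshCoeff f {i}) ^ 2) ≤
      40 * (D : ℝ) ^ 2 * M ^ 2 := by
  obtain ⟨c, ρ, hρ, hc, hcρ⟩ := exists_derivative_quadrature hD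
  have hM : 0 ≤ M := (apply_nonneg p _).trans (hfM 1)
  -- `a` is the symbol of the combination of noise operators, `e` that of the error
  set a : ℕ → ℝ := fun k => ∑ j ∈ Finset.range (3 * D), c j * ρ j ^ k with ha
  set e : ℕ → ℝ := fun k => (if k = 1 then 1 else 0) - a k with he
  have hη : ∀ k, |e k| ≤ 2 * D / 2 ^ D := by
    intro k
    rcases le_or_gt k D with hk | hk
    · simp only [he, ha, hcρ k hk, sub_self, abs_zero]
      positivity
    · simp only [he, ha]
      rw [if_neg (by omega), zero_sub, abs_neg]
      calc |∑ j ∈ Finset.range (3 * D), c j * ρ j ^ k|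
          ≤ ∑ j ∈ Finset.range (3 * D), |c j| * (1 / 2) ^ (D + 1) := by
            refine (Finset.abs_sum_le_sum_abs _ _).trans (Finset.sum_le_sum fun j _ => ?_)
            rw [abs_mul, abs_pow]
            refine mul_le_mul_of_nonneg_left ?_ (abs_nonneg _)
            exact (pow_le_pow_left₀ (abs_nonneg _) (hρ j) k).trans
              (pow_le_pow_of_le_one (by norm_num) (by norm_num) hk)
        _ ≤ 4 * D * (1 / 2) ^ (D + 1) := by
            rw [← Finset.sum_mul]
            gcongr
        _ = 2 * D / 2 ^ D := by
            rw [pow_succ, one_div, inv_pow]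
            field_simp
            norm_num
  have hpoint : ∀ x, p (∑ i, ((x i : ℤ) : ℝ) • walshCoeff f {i}) ≤
      4 * D * M + (∑ b ∈ s, |degreeMultiplier e (g b) x|) * M := by
    intro x
    have hfeq : f = fun y => ∑ b ∈ s, g b y • v b := funext hf
    have hsplit : ∑ i, ((x i : ℤ) : ℝ) • walshCoeff f {i} =
        degreeMultiplier a f x + degreeMultiplier e f x := by
      rw [he, degreeMultiplier_symbol_sub, ← degreeMultiplier_one]
      abel
    have h1 : p (degreeMultiplier a f x) ≤ 4 * D * M := by
      rw [ha, degreeMultiplier_symbol_sum]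
      refine (Finset.le_sum_of_subadditive p (map_zero p).le (map_add_le_add p) _ _).trans ?_
      calc _ ≤ ∑ j ∈ Finset.range (3 * D), |c j| * M := by
            refine Finset.sum_le_sum fun j _ => ?_
            rw [map_smul_eq_mul, Real.norm_eq_abs]
            exact mul_le_mul_of_nonneg_left
              (seminorm_noise_le p hfM ((hρ j).trans (by norm_num)) x) (abs_nonneg _)
        _ ≤ _ := by
            rw [← Finset.sum_mul]
            gcongr
    have h2 : p (degreeMultiplier e f x) ≤ (∑ b ∈ s, |degreeMultiplier e (g b) x|) * M := by
      rw [hfeq, degreeMultiplier_sum, Finset.sum_mul]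
      refine (Finset.le_sum_of_subadditive p (map_zero p).le (map_add_le_add p) _ _).trans ?_
      refine Finset.sum_le_sum fun b _ => ?_
      rw [map_smul_eq_mul, Real.norm_eq_abs]
      exact mul_le_mul_of_nonneg_left (hv b) (abs_nonneg _)
    rw [hsplit]
    exact (map_add_le_add p _ _).trans (add_le_add h1 h2)
  have hsq : ∀ x, p (∑ i, ((x i : ℤ) : ℝ) • walshCoeff f {i}) ^ 2 ≤
      32 * (D : ℝ) ^ 2 * M ^ 2 +
        (2 * s.card * M ^ 2) * ∑ b ∈ s, degreeMultiplier e (g b) x ^ 2 := by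
    intro x
    have h1 := pow_le_pow_left₀ (apply_nonneg p _) (hpoint x) 2
    have h2 := sq_sum_le_card_mul_sum_sq (s := s) (f := fun b => |degreeMultiplier e (g b) x|)
    simp only [sq_abs] at h2
    have h3 := mul_le_mul_of_nonneg_right h2 (sq_nonneg M)
    nlinarith [sq_nonneg (4 * D * M - (∑ b ∈ s, |degreeMultiplier e (g b) x|) * M)]
  have hL2 : ∀ b, cubeMean (fun x => degreeMultiplier e (g b) x ^ 2) ≤ (2 * D / 2 ^ D) ^ 2 := by
    intro b
    refine (cubeMean_sq_degreeMultiplier_le e _ hη (g b)).trans ?_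
    refine mul_le_of_le_one_right (sq_nonneg _) ?_
    refine (cubeMean_mono (g := fun _ => (1 : ℝ)) fun x => ?_).trans (cubeMean_const _).le
    rw [← sq_abs]
    exact pow_le_one₀ (abs_nonneg _) (hg b x)
  have hcard : (s.card : ℝ) * (2 * D / 2 ^ D) ≤ 2 * D := by
    have h : (s.card : ℝ) ≤ 2 ^ D := by exact_mod_cast hs
    calc (s.card : ℝ) * (2 * D / 2 ^ D) ≤ 2 ^ D * (2 * D / 2 ^ D) := by gcongr
      _ = 2 * D := by field_simp
  calc _ ≤ cubeMean (fun x => 32 * (D : ℝ) ^ 2 * M ^ 2 +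
        (2 * s.card * M ^ 2) * ∑ b ∈ s, degreeMultiplier e (g b) x ^ 2) := cubeMean_mono hsq
    _ = 32 * (D : ℝ) ^ 2 * M ^ 2 + (2 * s.card * M ^ 2) *
        ∑ b ∈ s, cubeMean (fun x => degreeMultiplier e (g b) x ^ 2) := by
        rw [cubeMean_add, cubeMean_const, cubeMean_mul, cubeMean_sum]
    _ ≤ 32 * (D : ℝ) ^ 2 * M ^ 2 + (2 * s.card * M ^ 2) * (s.card * (2 * D / 2 ^ D) ^ 2) := by
        gcongr
        rw [← nsmul_eq_mul]
        exact Finset.sum_le_card_nsmul _ _ _ fun b _ => hL2 b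
    _ = 32 * (D : ℝ) ^ 2 * M ^ 2 + 2 * M ^ 2 * (s.card * (2 * D / 2 ^ D)) ^ 2 := by ring
    _ ≤ 32 * (D : ℝ) ^ 2 * M ^ 2 + 2 * M ^ 2 * (2 * D) ^ 2 := by gcongr
    _ = _ := by ring

end Rademacher

/-! ### The cotype constant of a finite-dimensional space -/

section Cotype

variable {E : Type*} [AddCommGroup E] [Module ℝ E]

/-- A seminorm on a finite-dimensional space is equivalent to a finite sum of absolute values of
linear functionals, namely the coordinates of the quotient by its kernel. -/
lemma exists_equivalent_functionals [FiniteDimensional ℝ E] (p : Seminorm ℝ E) :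
    ∃ (d : ℕ) (φ : Fin d → E →ₗ[ℝ] ℝ) (c : ℝ), 0 ≤ c ∧ (∀ i x, |φ i x| ≤ c * p x) ∧
      ∀ x, p x ≤ c * ∑ i, |φ i x| := by
  let _ : SeminormedAddCommGroup E := p.toAddGroupSeminorm.toSeminormedAddCommGroup
  let _ : NormedSpace ℝ E := ⟨fun a x => (map_smul_eq_mul p a x).le⟩
  have hp : ∀ x, p x = ‖SeparationQuotient.mkCLM ℝ E x‖ := by
    intro x
    exact (SeparationQuotient.norm_mk x).symm
  let b := Module.finBasis ℝ (SeparationQuotient E)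
  let ψ : Fin _ → (SeparationQuotient E →L[ℝ] ℝ) := fun i => (b.coord i).toContinuousLinearMap
  set c : ℝ := ∑ i, (‖ψ i‖ + ‖b i‖) with hc
  have hle : ∀ i, ‖ψ i‖ + ‖b i‖ ≤ c := fun i =>
    Finset.single_le_sum (f := fun i => ‖ψ i‖ + ‖b i‖) (fun i _ => by positivity)
      (Finset.mem_univ i)
  refine ⟨_, fun i => (ψ i).toLinearMap ∘ₗ (SeparationQuotient.mkCLM ℝ E).toLinearMap, c,
    Finset.sum_nonneg fun i _ => by positivity, fun i x => ?_, fun x => ?_⟩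
  · rw [hp, ← Real.norm_eq_abs]
    refine ((ψ i).le_opNorm _).trans (mul_le_mul_of_nonneg_right ?_ (norm_nonneg _))
    linarith [hle i, norm_nonneg (b i)]
  · rw [hp, ← b.sum_repr (SeparationQuotient.mkCLM ℝ E x), Finset.mul_sum]
    refine (norm_sum_le _ _).trans (Finset.sum_le_sum fun i _ => ?_)
    rw [norm_smul, mul_comm, Real.norm_eq_abs]
    refine mul_le_mul_of_nonneg_right ?_ (abs_nonneg _)
    linarith [hle i, norm_nonneg (ψ i)]

lemma cubeMean_sq_rademacher_sum {k : ℕ} (a : Fin k → ℝ) :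
    cubeMean (fun ε : Fin k → ℤˣ => (∑ i, ((ε i : ℤ) : ℝ) * a i) ^ 2) = ∑ i, a i ^ 2 := by
  have h : ∀ ε : Fin k → ℤˣ, (∑ i, ((ε i : ℤ) : ℝ) * a i) ^ 2 =
      ∑ i, ∑ j, (a i * a j) * (walsh {i} ε * walsh {j} ε) := by
    intro ε
    rw [sq, Finset.sum_mul_sum]
    refine Finset.sum_congr rfl fun i _ => Finset.sum_congr rfl fun j _ => ?_
    simp only [walsh, Finset.prod_singleton]
    ring
  simp only [h, cubeMean_sum, cubeMean_mul, cubeMean_walsh_mul_walsh, Finset.singleton_inj]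
  simp [sq]

lemma rpow_sum_rpow_le_sqrt {k : ℕ} (a : Fin k → ℝ) (ha : ∀ i, 0 ≤ a i) {q : ℝ} (hq : 2 ≤ q) :
    (∑ i, a i ^ q) ^ (1 / q) ≤ Real.sqrt (∑ i, a i ^ 2) := by
  set S := Real.sqrt (∑ i, a i ^ 2) with hS
  have hS0 : 0 ≤ S := Real.sqrt_nonneg _
  have hsum : 0 ≤ ∑ i, a i ^ 2 := Finset.sum_nonneg fun i _ => sq_nonneg _
  have hle : ∀ i, a i ≤ S := fun i =>
    Real.le_sqrt_of_sq_le (Finset.single_le_sum (f := fun i => a i ^ 2)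
      (fun i _ => sq_nonneg _) (Finset.mem_univ i))
  have hsplit : ∀ t : ℝ, 0 ≤ t → t ^ q = t ^ 2 * t ^ (q - 2) := by
    intro t ht
    rw [← Real.rpow_natCast, ← Real.rpow_add_of_nonneg ht (by norm_num) (by linarith)]
    norm_num
  have h1 : ∑ i, a i ^ q ≤ S ^ q := by
    rw [hsplit S hS0, hS, Real.sq_sqrt hsum, ← hS, Finset.sum_mul]
    refine Finset.sum_le_sum fun i _ => ?_
    rw [hsplit _ (ha i)]
    exact mul_le_mul_of_nonneg_left (Real.rpow_le_rpow (ha i) (hle i) (by linarith)) (sq_nonneg _)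
  calc (∑ i, a i ^ q) ^ (1 / q) ≤ (S ^ q) ^ (1 / q) :=
        Real.rpow_le_rpow (Finset.sum_nonneg fun i _ => Real.rpow_nonneg (ha i) _) h1
          (by positivity)
    _ = S := by
        rw [one_div, Real.rpow_rpow_inv hS0 (by linarith)]

/-- Every seminorm on a finite-dimensional space has finite cotype `q` constant for `q ≥ 2`. -/
lemma exists_cotype_bound [FiniteDimensional ℝ E] (p : Seminorm ℝ E) {q : ℝ} (hq : 2 ≤ q) :
    ∃ C : ℝ, 0 < C ∧ ∀ (k : ℕ) (x : Fin k → E), (∑ i, p (x i) ^ q) ^ (1 / q) ≤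
      C * Real.sqrt (𝔼 ε : Fin k → ℤˣ, p (∑ i, ((ε i : ℤ) : ℝ) • x i) ^ 2) := by
  obtain ⟨d, φ, c, hc, h1, h2⟩ := exists_equivalent_functionals p
  -- the summand `1` only makes the constant positive when `c = 0` or `d = 0`
  refine ⟨c ^ 2 * d + 1, by positivity, fun k x => ?_⟩
  rw [cubeMean_eq_expect]
  set R := cubeMean (fun ε : Fin k → ℤˣ => p (∑ i, ((ε i : ℤ) : ℝ) • x i) ^ 2) with hR
  have hφ : ∀ b, ∑ i, φ b (x i) ^ 2 ≤ c ^ 2 * R := by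
    intro b
    rw [← cubeMean_sq_rademacher_sum, hR, ← cubeMean_mul]
    refine cubeMean_mono fun ε => ?_
    have h3 : ∑ i, ((ε i : ℤ) : ℝ) * φ b (x i) = φ b (∑ i, ((ε i : ℤ) : ℝ) • x i) := by
      simp [map_sum]
    rw [h3, ← mul_pow, ← sq_abs]
    exact pow_le_pow_left₀ (abs_nonneg _) (h1 b _) 2
  have hsum : ∑ i, p (x i) ^ 2 ≤ (c ^ 2 * d) ^ 2 * R := by
    calc ∑ i, p (x i) ^ 2 ≤ ∑ i, c ^ 2 * (d * ∑ b, φ b (x i) ^ 2) := by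
          refine Finset.sum_le_sum fun i _ => ?_
          refine (pow_le_pow_left₀ (apply_nonneg p _) (h2 (x i)) 2).trans ?_
          rw [mul_pow]
          refine mul_le_mul_of_nonneg_left ?_ (sq_nonneg c)
          have := sq_sum_le_card_mul_sum_sq (s := Finset.univ) (f := fun b => |φ b (x i)|)
          simpa only [sq_abs, Finset.card_univ, Fintype.card_fin] using this
      _ = c ^ 2 * (d * ∑ b, ∑ i, φ b (x i) ^ 2) := by
          rw [← Finset.mul_sum, ← Finset.mul_sum, Finset.sum_comm]
      _ ≤ c ^ 2 * (d * ∑ _b : Fin d, c ^ 2 * R) := by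
          gcongr with b
          exact hφ b
      _ = _ := by
          rw [Finset.sum_const, Finset.card_univ, Fintype.card_fin, nsmul_eq_mul]
          ring
  calc _ ≤ Real.sqrt (∑ i, p (x i) ^ 2) :=
        rpow_sum_rpow_le_sqrt _ (fun i => apply_nonneg p _) hq
    _ ≤ Real.sqrt ((c ^ 2 * d) ^ 2 * R) := Real.sqrt_le_sqrt hsum
    _ = c ^ 2 * d * Real.sqrt R := by
        rw [Real.sqrt_mul (sq_nonneg _), Real.sqrt_sq (by positivity)]
    _ ≤ _ := by
        have := Real.sqrt_nonneg R
        nlinarith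

/-- In finite dimension the infimum that defines the cotype constant is attained. -/
theorem cotype_inequality [FiniteDimensional ℝ E] (p : Seminorm ℝ E) {q : ℝ} (hq : 2 ≤ q)
    (k : ℕ) (x : Fin k → E) : (∑ i, p (x i) ^ q) ^ (1 / q) ≤
      cotypeConst p q *
        Real.sqrt (𝔼 ε : Fin k → ℤˣ, p (∑ i, ((ε i : ℤ) : ℝ) • x i) ^ 2) := by
  obtain ⟨C₀, hC₀⟩ := exists_cotype_bound p hq
  set R := Real.sqrt (𝔼 ε : Fin k → ℤˣ, p (∑ i, ((ε i : ℤ) : ℝ) • x i) ^ 2) with hR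
  rcases (Real.sqrt_nonneg _ : 0 ≤ R).eq_or_lt with h0 | h0
  · have := hC₀.2 k x
    have hR0 : R = 0 := h0.symm
    rw [← hR, hR0, mul_zero] at this
    rwa [hR0, mul_zero]
  · rw [← div_le_iff₀ h0]
    exact le_csInf ⟨C₀, hC₀⟩ fun C hC => (div_le_iff₀ h0).2 (hC.2 k x)

lemma cotypeConst_nonneg (p : Seminorm ℝ E) (q : ℝ) : 0 ≤ cotypeConst p q :=
  Real.sInf_nonneg fun _ hC => hC.1.le

end Cotype

/-! ### Cubes of sign vectors -/

section SignCube

variable {N : ℕ}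

/-- The tensor `ε ⊗ ε ⊗ ε` of a sign vector `ε`. -/
noncomputable def signCube (δ : Fin N → ℤˣ) : Tensor3 N :=
  Tensor3.tmul (signVec δ) (signVec δ) (signVec δ)

lemma coord_basis_signCube (δ : Fin N → ℤˣ) (i j k : Fin N) :
    (Tensor3.basis N).coord ((i, j), k) (signCube δ) =
      ((δ i : ℤ) : ℝ) * ((δ j : ℤ) : ℝ) * ((δ k : ℤ) : ℝ) := by
  have h := Module.Basis.tensorProduct_repr_tmul_apply
    ((Pi.basisFun ℝ (Fin N)).tensorProduct (Pi.basisFun ℝ (Fin N))) (Pi.basisFun ℝ (Fin N))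
    (signVec δ ⊗ₜ[ℝ] signVec δ) (signVec δ) (i, j) k
  have h' := Module.Basis.tensorProduct_repr_tmul_apply
    (Pi.basisFun ℝ (Fin N)) (Pi.basisFun ℝ (Fin N)) (signVec δ) (signVec δ) i j
  rw [h'] at h
  refine Eq.trans h ?_
  simp only [Pi.basisFun_repr, signVec, smul_eq_mul]
  ring

lemma finiteDimensional_tensor3 : FiniteDimensional ℝ (Tensor3 N) :=
  (Tensor3.basis N).finiteDimensional_of_finite

lemma seminorm_signCube_le (p : Seminorm ℝ (Tensor3 N)) (δ : Fin N → ℤˣ) :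
    p (signCube δ) ≤ maxSignCube p :=
  le_ciSup (f := fun ε : Fin N → ℤˣ => p (signCube ε)) (Set.finite_range _).bddAbove δ

/-- The supports of the products `δ ↦ δ i * δ j * δ k`, as sets of coordinates. -/
def tripleSupports (N : ℕ) : Finset (Finset (Fin N)) :=
  Finset.univ.image fun t : (Fin N × Fin N) × Fin N =>
    symmDiff (symmDiff {t.1.1} {t.1.2}) {t.2}

lemma card_tripleSupports_le : (tripleSupports N).card ≤ N ^ 3 := by
  refine Finset.card_image_le.trans ?_
  simp only [Finset.card_univ, Fintype.card_prod, Fintype.card_fin]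
  exact le_of_eq (by ring)

lemma walshCoeff_signCube_eq_zero {A : Finset (Fin N)} (hA : A ∉ tripleSupports N) :
    walshCoeff (signCube (N := N)) A = 0 := by
  refine (Tensor3.basis N).ext_elem fun t => ?_
  obtain ⟨⟨i, j⟩, k⟩ := t
  rw [map_zero, Finsupp.zero_apply, ← Module.Basis.coord_apply, walshCoeff, map_cubeMean]
  have h : ∀ δ : Fin N → ℤˣ,
      (Tensor3.basis N).coord ((i, j), k) (walsh A δ • signCube δ) =
        walsh A δ * walsh (symmDiff (symmDiff {i} {j}) {k}) δ := by
    intro δ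
    rw [map_smul, coord_basis_signCube, walsh_symmDiff, walsh_symmDiff]
    simp [walsh]
  simp only [h]
  rw [cubeMean_walsh_mul_walsh, if_neg]
  rintro rfl
  exact hA (Finset.mem_image.2 ⟨((i, j), k), Finset.mem_univ _, rfl⟩)

lemma seminorm_walshCoeff_le {ι E : Type*} [Fintype ι] [DecidableEq ι] [AddCommGroup E]
    [Module ℝ E] (p : Seminorm ℝ E) {f : (ι → ℤˣ) → E} {M : ℝ} (hf : ∀ x, p (f x) ≤ M)
    (A : Finset ι) : p (walshCoeff f A) ≤ M := by
  refine (seminorm_cubeMean_le p _).trans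
    ((cubeMean_mono (g := fun _ => M) fun x => ?_).trans (cubeMean_const M).le)
  rw [map_smul_eq_mul, Real.norm_eq_abs, abs_walsh, one_mul]
  exact hf x

/-- The cubes of sign vectors are combinations, with signs as coefficients, of their at most `N ^ 3`
nonzero Walsh coefficients, and these lie in the `p`-ball of radius `maxSignCube p`, being averages
of signed cubes. So the bound for Rademacher projections applies. -/
lemma cubeMean_sq_rademacher_signCube_le (p : Seminorm ℝ (Tensor3 N)) {m D : ℕ} (hD : 0 < D)
    (hN : N ^ 3 ≤ 2 ^ D) (F : (Fin m → ℤˣ) → (Fin N → ℤˣ)) :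
    cubeMean (fun x : Fin m → ℤˣ => p (∑ i, ((x i : ℤ) : ℝ) •
      walshCoeff (fun ε => signCube (F ε)) {i}) ^ 2) ≤ 40 * (D : ℝ) ^ 2 * maxSignCube p ^ 2 := by
  refine cubeMean_sq_rademacher_le p (tripleSupports N) (fun A x => walsh A (F x))
    (fun A => walshCoeff signCube A) hD (card_tripleSupports_le.trans hN)
    (fun A x => (abs_walsh _ _).le) (seminorm_walshCoeff_le p (seminorm_signCube_le p)) _
    (fun x => ?_) (fun x => seminorm_signCube_le p _)
  rw [← sum_walsh_smul_walshCoeff signCube (F x)]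
  symm
  refine Finset.sum_subset (Finset.subset_univ _) fun A _ hA => ?_
  rw [walshCoeff_signCube_eq_zero hA, smul_zero]

end SignCube

/-! ### Correlated query sets of a locally decodable code -/

section Decoding

variable {ι : Type*} [Fintype ι] [DecidableEq ι]

/-- The Walsh expansion of a function of the coordinates in `J`. -/
lemma sum_powerset_walsh_mul_walshCoeff (G : (ι → ℤˣ) → ℝ) (J : Finset ι)
    (hG : ∀ x y, (∀ i ∈ J, x i = y i) → G x = G y) (x : ι → ℤˣ) :
    G x = ∑ U ∈ J.powerset, walshCoeff G U * walsh U x := by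
  rw [← sum_walsh_smul_walshCoeff G x]
  symm
  simp only [mul_comm (walshCoeff G _)]
  refine Finset.sum_subset (Finset.subset_univ _) fun U _ hU => ?_
  rw [Finset.mem_powerset, Finset.not_subset] at hU
  obtain ⟨i, hiU, hiJ⟩ := hU
  have h0 : walshCoeff G U = 0 := by
    refine cubeMean_eq_zero_of_neg _ (Pi.mulSingle i (-1)) fun y => ?_
    have hy : G (y * Pi.mulSingle i (-1)) = G y := by
      refine hG _ _ fun j hj => ?_
      have hji : j ≠ i := fun h => hiJ (h ▸ hj)
      simp [hji]
    rw [walsh_mul, walsh_mulSingle, if_pos hiU, hy]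
    simp
  rw [h0, mul_zero]

/-- Randomizing the coordinates in `V` kills the Walsh functions whose support meets `V`. -/
lemma cubeMean_walsh_piecewise (U V : Finset ι) (c : ι → ℤˣ) :
    cubeMean (fun r => walsh U (V.piecewise r c)) = if Disjoint U V then walsh U c else 0 := by
  split_ifs with h
  · have : ∀ r : ι → ℤˣ, walsh U (V.piecewise r c) = walsh U c := by
      intro r
      refine Finset.prod_congr rfl fun i hi => ?_
      rw [Finset.piecewise_eq_of_notMem _ _ _ (Finset.disjoint_left.1 h hi)]
    simp only [this]
    exact cubeMean_const _
  · obtain ⟨i, hU, hV⟩ := Finset.not_disjoint_iff.1 h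
    refine cubeMean_eq_zero_of_neg _ (Pi.mulSingle i (-1)) fun r => ?_
    have hr : V.piecewise (r * Pi.mulSingle i (-1)) c =
        V.piecewise r c * Pi.mulSingle i (-1) := by
      funext j
      by_cases hj : j ∈ V
      · simp [hj]
      · have hji : j ≠ i := fun h => hj (h ▸ hV)
        simp [hj, hji]
    rw [hr, walsh_mul, walsh_mulSingle, if_pos hU, mul_neg_one]

lemma sum_toReal_pmf {α : Type*} [Fintype α] (A : PMF α) : ∑ a, (A a).toReal = 1 := by
  have h := A.tsum_coe
  rw [tsum_fintype] at h
  rw [← ENNReal.toReal_sum fun a _ => A.apply_ne_top a, h, ENNReal.toReal_one]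

/-- An event `X = u` of probability at least `1/2 + θ`, for a random sign `X`, gives correlation
`2 θ`. -/
lemma two_mul_le_sum_of_le_toOuterMeasure {α : Type*} [Fintype α] (A : PMF α) (X : α → ℤˣ)
    (u : ℤˣ) {θ : ℝ} (hA : ENNReal.ofReal (1 / 2 + θ) ≤ A.toOuterMeasure {a | X a = u}) :
    2 * θ ≤ ∑ a, (A a).toReal * (((u : ℤ) : ℝ) * ((X a : ℤ) : ℝ)) := by
  classical
  have hsum := sum_toReal_pmf A
  have hP : 1 / 2 + θ ≤ ∑ a, (A a).toReal * (if X a = u then 1 else 0) := by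
    rw [PMF.toOuterMeasure_apply_fintype] at hA
    have hne : ∀ a ∈ (Finset.univ : Finset α), Set.indicator {a | X a = u} A a ≠ ⊤ := by
      intro a _
      rw [Set.indicator_apply]
      split_ifs
      · exact A.apply_ne_top a
      · exact ENNReal.zero_ne_top
    rw [ENNReal.ofReal_le_iff_le_toReal (ENNReal.sum_ne_top.2 hne), ENNReal.toReal_sum hne] at hA
    refine hA.trans (Finset.sum_le_sum fun a _ => ?_)
    by_cases h : X a = u <;> simp [h]
  have hterm : ∀ a, (A a).toReal * (((u : ℤ) : ℝ) * ((X a : ℤ) : ℝ)) =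
      2 * ((A a).toReal * (if X a = u then 1 else 0)) - (A a).toReal := by
    intro a
    rcases Int.units_eq_one_or u with hu | hu <;>
      rcases Int.units_eq_one_or (X a) with hx | hx <;> simp [hu, hx] <;> ring
  simp only [hterm]
  rw [Finset.sum_sub_distrib, ← Finset.mul_sum, hsum]
  linarith

/-- The correlation, for a uniform message `ε`, of the bit `ε t` with the product of the bits
of the codeword `C ε` in `U`. -/
noncomputable def bitCorrelation {m n : ℕ} (C : (Fin m → ℤˣ) → (Fin n → ℤˣ)) (t : Fin m)
    (U : Finset (Fin n)) : ℝ :=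
  cubeMean fun ε => ((ε t : ℤ) : ℝ) * walsh U (C ε)

lemma bitCorrelation_empty {m n : ℕ} (C : (Fin m → ℤˣ) → (Fin n → ℤˣ)) (t : Fin m) :
    bitCorrelation C t ∅ = 0 := by
  have h := cubeMean_walsh_mul_walsh ({t} : Finset (Fin m)) ∅
  simpa [bitCorrelation, walsh] using h

/-- A function of three bits of a codeword that has been randomized on `V` correlates with `ε t`
only through the query sets disjoint from `V`. -/
lemma cubeMean_query_le {m n : ℕ} (C : (Fin m → ℤˣ) → (Fin n → ℤˣ)) (t : Fin m)
    (V : Finset (Fin n)) {η : ℝ} (hη : 0 ≤ η)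
    (hV : ∀ U : Finset (Fin n), Disjoint U V → U.Nonempty → U.card ≤ 3 → |bitCorrelation C t U| ≤ η)
    (i j k : Fin n) (g : ℤˣ × ℤˣ × ℤˣ → ℤˣ) :
    cubeMean (fun ε => cubeMean fun r => ((ε t : ℤ) : ℝ) *
      ((g (V.piecewise r (C ε) i, V.piecewise r (C ε) j, V.piecewise r (C ε) k) : ℤ) : ℝ)) ≤
      8 * η := by
  set G : (Fin n → ℤˣ) → ℝ := fun δ => ((g (δ i, δ j, δ k) : ℤ) : ℝ) with hG
  have hcoeff : ∀ U, |walshCoeff G U| ≤ 1 := by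
    intro U
    refine (abs_cubeMean_le _).trans
      ((cubeMean_mono (g := fun _ => (1 : ℝ)) fun x => ?_).trans (cubeMean_const _).le)
    simp [hG, abs_mul, abs_walsh, abs_unit_sign]
  set J : Finset (Fin n) := {i, j, k} with hJ
  have hexp := sum_powerset_walsh_mul_walshCoeff G J (by
    intro x y hxy
    simp only [hG, hxy i (by simp [hJ]), hxy j (by simp [hJ]), hxy k (by simp [hJ])])
  have hmean : cubeMean (fun ε => cubeMean fun r => ((ε t : ℤ) : ℝ) * G (V.piecewise r (C ε))) =
      ∑ U ∈ J.powerset, walshCoeff G U *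
        (if Disjoint U V then bitCorrelation C t U else 0) := by
    have h1 : ∀ ε : Fin m → ℤˣ,
        cubeMean (fun r => ((ε t : ℤ) : ℝ) * G (V.piecewise r (C ε))) =
        ∑ U ∈ J.powerset, walshCoeff G U *
          (((ε t : ℤ) : ℝ) * (if Disjoint U V then walsh U (C ε) else 0)) := by
      intro ε
      rw [cubeMean_mul]
      simp only [hexp, cubeMean_sum, cubeMean_mul, cubeMean_walsh_piecewise, Finset.mul_sum]
      exact Finset.sum_congr rfl fun U _ => by ring
    simp only [h1, cubeMean_sum, cubeMean_mul]
    refine Finset.sum_congr rfl fun U _ => ?_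
    split_ifs
    · rfl
    · simp only [mul_zero]
      rw [cubeMean_const, mul_zero]
  have hJcard : J.card ≤ 3 := Finset.card_le_three
  rw [hmean]
  calc _ ≤ ∑ U ∈ J.powerset, η := by
        refine Finset.sum_le_sum fun U hU => ?_
        have hb : |if Disjoint U V then bitCorrelation C t U else 0| ≤ η := by
          split_ifs with hd
          · rcases U.eq_empty_or_nonempty with rfl | hne
            · rwa [bitCorrelation_empty, abs_zero]
            · exact hV U hd hne ((Finset.card_le_card (Finset.mem_powerset.1 hU)).trans hJcard)
          · rwa [abs_zero]
        refine (le_abs_self _).trans ?_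
        rw [abs_mul]
        exact (mul_le_of_le_one_left (abs_nonneg _) (hcoeff U)).trans hb
    _ = (2 ^ J.card : ℕ) * η := by
        rw [Finset.sum_const, Finset.card_powerset, nsmul_eq_mul]
    _ ≤ 8 * η := by
        refine mul_le_mul_of_nonneg_right ?_ hη
        exact_mod_cast (Nat.pow_le_pow_right (by norm_num) hJcard : 2 ^ J.card ≤ 2 ^ 3)

/-- The Katz–Trevisan argument: if the coordinates in a set `V` of size at most `φ n` are
randomized, the decoder still works, hence it must use a query set disjoint from `V`. -/
lemma exists_correlated_disjoint {m n : ℕ} {φ θ : ℝ} (hθ : 0 < θ)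
    {C : (Fin m → ℤˣ) → (Fin n → ℤˣ)} (hC : IsThreeQueryLDC φ θ C) (t : Fin m)
    (V : Finset (Fin n)) (hV : (V.card : ℝ) ≤ φ * n) :
    ∃ U : Finset (Fin n), Disjoint U V ∧ U.Nonempty ∧ U.card ≤ 3 ∧
      θ / 8 ≤ |bitCorrelation C t U| := by
  by_contra! hcon
  obtain ⟨A, hA⟩ := hC t
  have hsum := sum_toReal_pmf A
  let δ : (Fin m → ℤˣ) → (Fin n → ℤˣ) → (Fin n → ℤˣ) := fun ε r => V.piecewise r (C ε)
  have hlow : ∀ ε r, 2 * θ ≤ ∑ a, (A a).toReal * (((ε t : ℤ) : ℝ) *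
      ((a.2.2.2 (δ ε r a.1, δ ε r a.2.1, δ ε r a.2.2.1) : ℤ) : ℝ)) := by
    intro ε r
    refine two_mul_le_sum_of_le_toOuterMeasure A _ (ε t) (hA ε (δ ε r) (le_trans ?_ hV))
    rw [Nat.cast_le]
    refine Finset.card_le_card fun i hi => ?_
    by_contra hiV
    simp [δ, hiV] at hi
  have hmean : 2 * θ ≤ ∑ a, (A a).toReal * cubeMean (fun ε => cubeMean fun r =>
      ((ε t : ℤ) : ℝ) * ((a.2.2.2 (δ ε r a.1, δ ε r a.2.1, δ ε r a.2.2.1) : ℤ) : ℝ)) := by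
    simp only [← cubeMean_mul, ← cubeMean_sum]
    calc 2 * θ = cubeMean (fun _ : Fin m → ℤˣ => cubeMean fun _ : Fin n → ℤˣ => 2 * θ) := by
          rw [cubeMean_const, cubeMean_const]
      _ ≤ _ := cubeMean_mono fun ε => cubeMean_mono fun r => hlow ε r
  have hup : 2 * θ ≤ ∑ a, (A a).toReal * (8 * (θ / 8)) :=
    hmean.trans (Finset.sum_le_sum fun a _ => mul_le_mul_of_nonneg_left
      (cubeMean_query_le C t V (by positivity) (fun U h1 h2 h3 => (hcon U h1 h2 h3).le)
        a.1 a.2.1 a.2.2.1 a.2.2.2) ENNReal.toReal_nonneg)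
  rw [← Finset.sum_mul, hsum] at hup
  linarith

/-- A greedy choice of disjoint query sets that correlate with the bit `ε t`. -/
lemma exists_correlated_matching {m n : ℕ} {φ θ : ℝ} (hθ : 0 < θ)
    {C : (Fin m → ℤˣ) → (Fin n → ℤˣ)} (hC : IsThreeQueryLDC φ θ C) (t : Fin m) (L : ℕ)
    (hL : 3 * (L : ℝ) ≤ φ * n + 3) :
    ∃ U : ℕ → Finset (Fin n), (∀ j < L, (U j).Nonempty ∧ (U j).card ≤ 3 ∧
      θ / 8 ≤ |bitCorrelation C t (U j)|) ∧ ∀ j < L, ∀ k < j, Disjoint (U j) (U k) := by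
  induction L with
  | zero => exact ⟨fun _ => ∅, by simp, by simp⟩
  | succ L ih =>
    push_cast at hL
    obtain ⟨U, hU, hdisj⟩ := ih (by linarith)
    have hcard : ((Finset.range L).biUnion U).card ≤ L * 3 := by
      refine (Finset.card_biUnion_le_card_mul _ _ 3 fun j hj => ?_).trans_eq (by simp)
      exact (hU j (Finset.mem_range.1 hj)).2.1
    have hcard' : ((((Finset.range L).biUnion U).card : ℕ) : ℝ) ≤ L * 3 := by exact_mod_cast hcard
    obtain ⟨W, hW, hW'⟩ := exists_correlated_disjoint hθ hC t ((Finset.range L).biUnion U)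
      (by linarith)
    rw [Finset.disjoint_biUnion_right] at hW
    refine ⟨Function.update U L W, fun j hj => ?_, fun j hj k hk => ?_⟩
    · rcases Nat.lt_succ_iff_lt_or_eq.1 hj with h | rfl
      · rw [Function.update_of_ne h.ne]
        exact hU j h
      · rw [Function.update_self]
        exact hW'
    · rw [Function.update_of_ne (by omega : k ≠ L)]
      rcases Nat.lt_succ_iff_lt_or_eq.1 hj with h | rfl
      · rw [Function.update_of_ne h.ne]
        exact hdisj j h k hk
      · rw [Function.update_self]
        exact hW k (Finset.mem_range.2 hk)

/-- The word `c` of length `n`, followed by `2 n` ones. -/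
def padOnes {n : ℕ} (c : Fin n → ℤˣ) (x : Fin (3 * n)) : ℤˣ :=
  if (finProdFinEquiv.symm x).1 = 0 then c (finProdFinEquiv.symm x).2 else 1

/-- Every product of one, two or three bits is a product of exactly three bits of the padded word,
in positions that reduce modulo `n` to the original ones. -/
lemma exists_triple_of_card_le_three {n : ℕ} (U : Finset (Fin n)) (hU : U.Nonempty)
    (hcard : U.card ≤ 3) :
    ∃ i j k : Fin (3 * n), ((finProdFinEquiv.symm i).2 ∈ U ∧ (finProdFinEquiv.symm j).2 ∈ U ∧
      (finProdFinEquiv.symm k).2 ∈ U) ∧ ∀ c : Fin n → ℤˣ, walsh U c =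
        ((padOnes c i : ℤ) : ℝ) * ((padOnes c j : ℤ) : ℝ) * ((padOnes c k : ℤ) : ℝ) := by
  have hpos := hU.card_pos
  obtain h | h | h : U.card = 1 ∨ U.card = 2 ∨ U.card = 3 := by omega
  · obtain ⟨a, rfl⟩ := Finset.card_eq_one.1 h
    refine ⟨finProdFinEquiv (0, a), finProdFinEquiv (1, a), finProdFinEquiv (1, a), ?_, fun c => ?_⟩
    · simp only [Equiv.symm_apply_apply]
      simp
    · simp [walsh, padOnes]
  · obtain ⟨a, b, hab, rfl⟩ := Finset.card_eq_two.1 h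
    refine ⟨finProdFinEquiv (0, a), finProdFinEquiv (0, b), finProdFinEquiv (1, a), ?_, fun c => ?_⟩
    · simp only [Equiv.symm_apply_apply]
      simp
    · simp [walsh, padOnes, Finset.prod_pair hab]
  · obtain ⟨a, b, d, hab, had, hbd, rfl⟩ := Finset.card_eq_three.1 h
    refine ⟨finProdFinEquiv (0, a), finProdFinEquiv (0, b), finProdFinEquiv (0, d), ?_, fun c => ?_⟩
    · simp only [Equiv.symm_apply_apply]
      simp
    · simp [walsh, padOnes, hab, had, hbd, mul_assoc]

lemma exists_perm_extending {N : ℕ} (L : ℕ) (h : ℕ → Fin N)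
    (hinj : ∀ j < L, ∀ k < j, h j ≠ h k) :
    ∃ π : Equiv.Perm (Fin N), ∀ j : Fin N, (j : ℕ) < L → π j = h j := by
  have hinj' : Set.InjOn (fun j : Fin N => h j)
      (Finset.univ.filter fun j : Fin N => (j : ℕ) < L) := by
    intro j hj k hk hjk
    simp only [Finset.coe_filter, Finset.mem_univ, true_and, Set.mem_ofPred_eq] at hj hk
    rcases lt_trichotomy (j : ℕ) k with hlt | heq | hlt
    · exact absurd hjk.symm (hinj k hk j hlt)
    · exact Fin.ext heq
    · exact absurd hjk (hinj j hj k hlt)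
  obtain ⟨g, hg⟩ := Finset.exists_equiv_extend_of_card_eq (t := Finset.univ)
    (by simp) (Finset.subset_univ _) hinj'
  refine ⟨g.trans (Equiv.subtypeUnivEquiv fun x => Finset.mem_univ x), fun j hj => ?_⟩
  exact hg j (by simpa using hj)

/-- The Rademacher coefficients of the cube of a padded locally decodable code have large
generalized diagonals. -/
theorem walshCoeff_signCube_padOnes_mem {m n : ℕ} {φ θ : ℝ} (hφ : 0 < φ) (hθ : 0 < θ)
    (hθ1 : θ < 1 / 2) {C : (Fin m → ℤˣ) → (Fin n → ℤˣ)} (hC : IsThreeQueryLDC φ θ C)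
    (hn : 0 < n) (t : Fin m) :
    walshCoeff (fun ε => signCube (padOnes (C ε))) {t} ∈
      largeDiagSet (3 * n) (θ / 8) (φ * θ / 27) := by
  set L := ⌈φ * θ / 27 * ((3 * n : ℕ) : ℝ)⌉₊ with hLdef
  have hφn : 0 ≤ φ * n := by positivity
  have hL : 3 * (L : ℝ) ≤ φ * n + 3 := by
    have h1 := Nat.ceil_lt_add_one (a := φ * θ / 27 * ((3 * n : ℕ) : ℝ)) (by positivity)
    rw [← hLdef] at h1
    push_cast at h1
    nlinarith
  obtain ⟨U, hU, hdisj⟩ := exists_correlated_matching hθ hC t L hL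
  -- a default value for the indices beyond `L`
  have x₀ : Fin (3 * n) := ⟨0, by omega⟩
  have hex : ∀ l : ℕ, ∃ i j k : Fin (3 * n), l < L → ((finProdFinEquiv.symm i).2 ∈ U l ∧
      (finProdFinEquiv.symm j).2 ∈ U l ∧ (finProdFinEquiv.symm k).2 ∈ U l) ∧
      ∀ c : Fin n → ℤˣ, walsh (U l) c =
        ((padOnes c i : ℤ) : ℝ) * ((padOnes c j : ℤ) : ℝ) * ((padOnes c k : ℤ) : ℝ) := by
    intro l
    by_cases hl : l < L
    · obtain ⟨i, j, k, h⟩ := exists_triple_of_card_le_three (U l) (hU l hl).1 (hU l hl).2.1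
      exact ⟨i, j, k, fun _ => h⟩
    · exact ⟨x₀, x₀, x₀, fun h => absurd h hl⟩
  choose i j k hijk using hex
  have hne : ∀ h : ℕ → Fin (3 * n), (∀ l < L, (finProdFinEquiv.symm (h l)).2 ∈ U l) →
      ∀ l < L, ∀ l' < l, h l ≠ h l' := by
    intro h hmem l hl l' hl' heq
    refine Finset.disjoint_left.1 (hdisj l hl l' hl') (hmem l hl) ?_
    rw [heq]
    exact hmem l' (hl'.trans hl)
  obtain ⟨π, hπ⟩ := exists_perm_extending L i (hne i fun l hl => (hijk l hl).1.1)
  obtain ⟨σ, hσ⟩ := exists_perm_extending L j (hne j fun l hl => (hijk l hl).1.2.1)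
  obtain ⟨τ, hτ⟩ := exists_perm_extending L k (hne k fun l hl => (hijk l hl).1.2.2)
  refine ⟨π, σ, τ, fun l hl => ?_⟩
  have hcoeff : Tensor3.coeff (walshCoeff (fun ε => signCube (padOnes (C ε))) {t})
      (i l) (j l) (k l) = bitCorrelation C t (U l) := by
    rw [Tensor3.coeff, ← Module.Basis.coord_apply, walshCoeff, map_cubeMean, bitCorrelation]
    congr 1
    funext ε
    rw [map_smul, coord_basis_signCube, (hijk l hl).2]
    simp [walsh]
  rw [hπ l hl, hσ l hl, hτ l hl, hcoeff]
  exact (hU l hl).2.2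

end Decoding

/-! ### The lower bound on the length of the code -/

lemma nat_log_add_one_le {n : ℕ} (hn : 0 < n) :
    ((Nat.log 2 (3 * n) + 1 : ℕ) : ℝ) ≤ 6 * Real.log ((n : ℝ) + 1) := by
  have h1 : 2 ^ (Nat.log 2 (3 * n) + 1) ≤ (n + 1) ^ 3 := by
    have := Nat.pow_log_le_self 2 (x := 3 * n) (by omega)
    rw [pow_succ]
    have h2 : 3 * n ≤ (n + 1) ^ 2 := by nlinarith
    calc _ ≤ (n + 1) ^ 2 * (n + 1) := Nat.mul_le_mul (this.trans h2) (by omega)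
      _ = _ := by ring
  have h2 : ((2 : ℝ)) ^ (Nat.log 2 (3 * n) + 1) ≤ ((n : ℝ) + 1) ^ 3 := by exact_mod_cast h1
  have h3 := Real.log_le_log (by positivity) h2
  rw [Real.log_pow, Real.log_pow] at h3
  have h4 := Real.log_two_gt_d9
  have h5 : (0 : ℝ) ≤ ((Nat.log 2 (3 * n) + 1 : ℕ) : ℝ) := Nat.cast_nonneg _
  push_cast at h3 h5 ⊢
  nlinarith

theorem theorem4 :
    ∃ K : ℝ, 0 < K ∧
      ∀ (m n : ℕ) (φ θ : ℝ), 0 < m → 0 < n →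
        0 < φ → φ < 1 / 2 → 0 < θ → θ < 1 / 2 →
        (∃ C : (Fin m → ℤˣ) → (Fin n → ℤˣ), IsThreeQueryLDC φ θ C) →
        ∀ (p : Seminorm ℝ (Tensor3 (3 * n))) (q : ℝ), 2 ≤ q →
          (m : ℝ) ^ (1 / q) / Real.log ((n : ℝ) + 1) * minLargeDiag p (θ / 8) (φ * θ / 27) ≤
            K * (cotypeConst p q * maxSignCube p) := by
  -- `126 = 7 * 18`, where `7 ≥ √40` and `D ≤ 18 log (n + 1)` for the degree `D` chosen below
  refine ⟨126, by norm_num, ?_⟩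
  rintro m n φ θ - hn hφ - hθ hθ1 ⟨C, hC⟩ p q hq
  have _ := finiteDimensional_tensor3 (N := 3 * n)
  have hlog : 0 < Real.log ((n : ℝ) + 1) := Real.log_pos (by simpa using hn)
  -- the smallest convenient degree with `N ^ 3 ≤ 2 ^ D` for `N = 3 n`
  set D : ℕ := 3 * (Nat.log 2 (3 * n) + 1) with hD
  have hDlog : (D : ℝ) ≤ 18 * Real.log ((n : ℝ) + 1) := by
    have := nat_log_add_one_le hn
    rw [hD, Nat.cast_mul]
    push_cast at this ⊢
    linarith
  have hN : (3 * n) ^ 3 ≤ 2 ^ D := by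
    rw [hD, mul_comm 3 (_ + 1), pow_mul]
    exact Nat.pow_le_pow_left (Nat.lt_pow_succ_log_self (by norm_num) _).le 3
  set O := maxSignCube p with hO
  have hO0 : 0 ≤ O := (apply_nonneg p _).trans (seminorm_signCube_le p 1)
  set S := minLargeDiag p (θ / 8) (φ * θ / 27) with hS
  have hS0 : 0 ≤ S := Real.sInf_nonneg (by rintro _ ⟨x, -, rfl⟩; exact apply_nonneg p x)
  set x : Fin m → Tensor3 (3 * n) := fun t => walshCoeff (fun ε => signCube (padOnes (C ε))) {t}
    with hx
  have hSx : ∀ t, S ≤ p (x t) := fun t =>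
    csInf_le ⟨0, by rintro _ ⟨x, -, rfl⟩; exact apply_nonneg p x⟩
      ⟨x t, walshCoeff_signCube_padOnes_mem hφ hθ hθ1 hC hn t, rfl⟩
  have hq0 : q ≠ 0 := by linarith
  have hlower : (m : ℝ) ^ (1 / q) * S ≤ (∑ t, p (x t) ^ q) ^ (1 / q) := by
    have h1 : (m : ℝ) * S ^ q ≤ ∑ t, p (x t) ^ q := by
      have := Finset.card_nsmul_le_sum Finset.univ (fun t => p (x t) ^ q) (S ^ q) fun t _ =>
        Real.rpow_le_rpow hS0 (hSx t) (by linarith)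
      simpa using this
    calc (m : ℝ) ^ (1 / q) * S = ((m : ℝ) * S ^ q) ^ (1 / q) := by
          rw [Real.mul_rpow (Nat.cast_nonneg _) (Real.rpow_nonneg hS0 _), one_div,
            Real.rpow_rpow_inv hS0 hq0]
      _ ≤ _ := Real.rpow_le_rpow (by positivity) h1 (by positivity)
  have hrad : Real.sqrt (𝔼 ε : Fin m → ℤˣ, p (∑ t, ((ε t : ℤ) : ℝ) • x t) ^ 2) ≤ 7 * D * O := by
    rw [cubeMean_eq_expect]
    refine Real.sqrt_le_iff.2 ⟨by positivity, ?_⟩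
    refine (cubeMean_sq_rademacher_signCube_le p (by omega) hN fun ε => padOnes (C ε)).trans ?_
    rw [mul_pow, mul_pow]
    gcongr
    norm_num
  have hc0 := cotypeConst_nonneg p q
  have hmain : (m : ℝ) ^ (1 / q) * S ≤ cotypeConst p q * (7 * D * O) :=
    hlower.trans ((cotype_inequality p hq m x).trans (mul_le_mul_of_nonneg_left hrad hc0))
  rw [div_mul_eq_mul_div, div_le_iff₀ hlog]
  calc _ ≤ cotypeConst p q * (7 * D * O) := hmain
    _ ≤ cotypeConst p q * (7 * (18 * Real.log ((n : ℝ) + 1)) * O) := by gcongr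
    _ = _ := by ring
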